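/- Let $F$ be a field and $n\ge 0$. Let $V$ be the $F$-vector space with basis $\{v(A) : \emptyset\ne A\subseteq\{1,\dots,n\}\}$, let $T(V)$ be its tensor algebra, and put $v(\emptyset)=0$. Let $Q_n$ be the quotient of $T(V)$ by the two-sided ideal generated by the elements $$v(A)\bigl(v(A\setminus\{i\})-v(A\setminus\{j\})\bigr)+\bigl(v(A\setminus\{i\})-v(A\setminus\{j\})\bigr)v(A\setminus\{i,j\})-v(A\setminus\{i\})^2+v(A\setminus\{j\})^2$$ for $A\subseteq\{1,\dots,n\}$ and distinct $i,j\in A$. For $i\ge 0$ let $Q_{n,i}\subseteq Q_n$ be the image of the span of all products $v(A_1)\cdots v(A_i)$ of $i$ generators. Then $Q_n=\bigoplus_{i\ge 0}Q_{n,i}$, every $Q_{n,i}$ is finite-dimensional, and the Hilbert series $H(Q_n,t)=\sum_{i\ge 0}(\dim_F Q_{n,i})\,t^i$ is an invertible formal power series in $\mathbb{Q}[[t]]$. Moreover, for every $n\ge 1$, $$\frac{1}{H(Q_n,t)}=(2-t)\,\frac{1}{H(Q_{n-1},t)}-1 .$$ -/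

import Mathlib

noncomputable section

namespace PseudoRoots

open FreeAlgebra

/-- The index set of the generators: nonempty subsets of an `n`-element ordered set, with `Fin n`
standing for `{1, …, n}`. -/
abbrev NonemptySubset (n : ℕ) : Type := {A : Finset (Fin n) // A.Nonempty}

/-- The tensor algebra `T(V)` of the vector space `V` over `F` with basis
`v(A)`, `∅ ≠ A ⊆ {1, …, n}`, that is, the free associative unital algebra on the `v(A)`. -/
abbrev TV (F : Type*) [Field F] (n : ℕ) : Type _ := FreeAlgebra F (NonemptySubset n)

/-- The element `v(A)` of `T(V)`, with the convention `v(∅) = 0`. -/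
def v (F : Type*) [Field F] {n : ℕ} (A : Finset (Fin n)) : TV F n :=
  if h : A.Nonempty then ι F ⟨A, h⟩ else 0

/-- The quadratic element `𝒱(A : {i, j})` of `T(V)`, where `i, j ∈ A`: the antisymmetrization in
`i` and `j` of `v(A) v(A \ i) - v(A \ i)² + v(A \ i) v(A \ i \ j)`. -/
def quadElt (F : Type*) [Field F] {n : ℕ} (A : Finset (Fin n)) (i j : Fin n) : TV F n :=
  (v F A * v F (A.erase i) - v F (A.erase i) ^ 2
      + v F (A.erase i) * v F ((A.erase i).erase j))
    - (v F A * v F (A.erase j) - v F (A.erase j) ^ 2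
      + v F (A.erase j) * v F ((A.erase j).erase i))

/-- The defining relations: `𝒱(A : {i, j}) = 0` for distinct `i, j ∈ A`. -/
inductive Rel (F : Type*) [Field F] (n : ℕ) : TV F n → TV F n → Prop
  | quad (A : Finset (Fin n)) (i j : Fin n) (hi : i ∈ A) (hj : j ∈ A) (hij : i ≠ j) :
      Rel F n (quadElt F A i j) 0

/-- The algebra `Q_n = T(V) / ⟨𝒱(A : B) : B ⊆ A, |B| = 2⟩`. -/
abbrev Q (F : Type*) [Field F] (n : ℕ) : Type _ := RingQuot (Rel F n)

/-- `T(V)_i`: the span of the products `v(A₁) ⋯ v(A_i)` of `i` generators. -/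
def TVgrade (F : Type*) [Field F] (n i : ℕ) : Submodule F (TV F n) :=
  Submodule.span F {x | ∃ w : List (NonemptySubset n), w.length = i ∧ x = (w.map (ι F)).prod}

/-- `Q_{n,i}`: the image of `T(V)_i` in `Q_n`. -/
def Qgrade (F : Type*) [Field F] (n i : ℕ) : Submodule F (Q F n) :=
  (TVgrade F n i).map (RingQuot.mkAlgHom F (Rel F n)).toLinearMap

/-- The Hilbert series `∑ (dim W_i) t^i` of a graded vector space with finite-dimensional
homogeneous components `W_i`, as a formal power series. -/
def hilbertSeries {F W : Type*} [Field F] [AddCommGroup W] [Module F W]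
    (𝒲 : ℕ → Submodule F W) : PowerSeries ℚ :=
  PowerSeries.mk fun i => (Module.finrank F (𝒲 i) : ℚ)

/-- `H(Q_n, t)`. -/
def HQ (F : Type*) [Field F] (n : ℕ) : PowerSeries ℚ := hilbertSeries (Qgrade F n)

end PseudoRoots

end

/-! The relations say that linear factors can be exchanged. For a chain of subsets from ∅ to A,
multiply the factors t - (v(B ∪ i) - v(B)), with t central and later factors on the left. The
vanishing of 𝒱(A : {i, j}) lets two adjacent steps of the chain be swapped (`linear_factors_swap`),
so the product depends only on A. This gives monic polynomials P_A of degree |A| over Q_n, and P_A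
is a right factor of P_B whenever A ⊆ B.

Let (A, k) denote the coefficient of t^(|A|-k) in P_A; it is homogeneous of degree k. The normal
words in these letters form a basis of Q_n (`wordBasis`). To prove this, the span of the normal
words is made into a right Q_n-module. A submodule `divSub` of "multiples of P_A" is complementary
to the polynomials of degree below |A| (`divSub_sup_lowSub`, `divSub_inf_lowSub`), which is division
with remainder. Hence x P_A can be defined as the unique multiple of degree at most |A| with
coefficient x at t^|A|. Uniqueness forces the factorization `monicAct_step`, and that forces the
defining relations (`vAct_rel`). Evaluating words in Q_n and acting on the empty word are then
mutually inverse.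

The Hilbert series H therefore counts normal words. Sorting them by last letter gives a triangular
linear system: the words that may be followed by A have series H (1-t)^(n-|A|) (`freeSeries_eq`).
Summing over all letters gives H (1 - t(2-t)^n) = 1 - t (`wordSeries_mul`), from which the recursion
is immediate. -/

namespace PseudoRoots

noncomputable section

/-! ### Normal words -/

section Words

variable {n : ℕ}

/-- A word, stored with its last letter first, may be followed by a letter `(A, k)`: its last letter
`(B, j)` is not such that `A ⊆ B` and `|A| = |B| - j`. -/
def Free (A : Finset (Fin n)) : List (Finset (Fin n) × ℕ) → Prop
  | [] => True
  | (B, j) :: _ => ¬ (A ⊆ B ∧ A.card + j = B.card)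

/-- The normal words in the letters `(A, k)`, `1 ≤ k ≤ |A|`, stored with the last letter first. -/
def Normal : List (Finset (Fin n) × ℕ) → Prop
  | [] => True
  | (A, k) :: w => 1 ≤ k ∧ k ≤ A.card ∧ Free A w ∧ Normal w

/-- The type of normal words. -/
abbrev Word (n : ℕ) : Type := {l : List (Finset (Fin n) × ℕ) // Normal l}

/-- The empty word. -/
def Word.nil : Word n := ⟨[], trivial⟩

open Classical in
/-- Append the letter `(B, s)` to a word, where `(B, 0)` stands for the empty word. -/
def Word.extend (B : Finset (Fin n)) (s : ℕ) (w : Word n) : Word n :=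
  if h : 1 ≤ s ∧ s ≤ B.card ∧ Free B w.1 then ⟨(B, s) :: w.1, h.1, h.2.1, h.2.2, w.2⟩ else w

lemma Word.extend_zero (B : Finset (Fin n)) (w : Word n) : w.extend B 0 = w := by
  simp [Word.extend]

lemma Word.extend_val {B : Finset (Fin n)} {s : ℕ} {w : Word n} (h1 : 1 ≤ s) (h2 : s ≤ B.card)
    (h3 : Free B w.1) : (w.extend B s).1 = (B, s) :: w.1 := by
  simp [Word.extend, h1, h2, h3]

lemma Word.free_extend {A B : Finset (Fin n)} {s : ℕ} {w : Word n} (h1 : 1 ≤ s)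
    (h2 : s ≤ B.card) (h3 : Free B w.1) (h : ¬ (A ⊆ B ∧ A.card + s = B.card)) :
    Free A (w.extend B s).1 := by
  rw [Word.extend_val h1 h2 h3]
  exact h

lemma Word.free_or_exists (A : Finset (Fin n)) (u : Word n) :
    Free A u.1 ∨ ∃ (B : Finset (Fin n)) (j : ℕ) (w : Word n), Free B w.1 ∧ 1 ≤ j ∧ A ⊆ B ∧
      A.card + j = B.card ∧ u = w.extend B j ∧ u.1.length = w.1.length + 1 := by
  obtain ⟨l, hl⟩ := u
  match l, hl with
  | [], _ => exact Or.inl trivial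
  | (B, j) :: w, hl =>
    by_cases h : A ⊆ B ∧ A.card + j = B.card
    · refine Or.inr ⟨B, j, ⟨w, hl.2.2.2⟩, hl.2.2.1, hl.1, h.1, h.2, ?_, by simp⟩
      exact Subtype.ext (Word.extend_val (w := ⟨w, hl.2.2.2⟩) hl.1 hl.2.1 hl.2.2.1).symm
    · exact Or.inl h

end Words

/-! ### Division with remainder over the space of words -/

section WordModule

variable (F : Type*) [Field F] {n : ℕ}

/-- The vector space with basis the normal words. -/
abbrev WordSpace (n : ℕ) : Type _ := Word n →₀ F

instance : AddCommGroup (WordSpace F n) := Finsupp.instAddCommGroup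

/-- Polynomials with coefficients in the space of normal words. -/
abbrev WordPoly (n : ℕ) : Type _ := ℕ →₀ WordSpace F n

instance : AddCommGroup (WordPoly F n) := Finsupp.instAddCommGroup

/-- Multiplication by the polynomial variable. -/
def shift : WordPoly F n →ₗ[F] WordPoly F n := Finsupp.lmapDomain (WordSpace F n) F Nat.succ

/-- The basis vector attached to a word. -/
abbrev vec (w : Word n) : WordSpace F n := Finsupp.single w 1

/-- The polynomial `t ^ m * ∑ s, t ^ (|B| - s) w (B, s)`. -/
def wordGen (B : Finset (Fin n)) (w : Word n) (m : ℕ) : WordPoly F n :=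
  ∑ s ∈ Finset.range (B.card + 1), Finsupp.single (m + (B.card - s)) (vec F (w.extend B s))

/-- The submodule of polynomials divisible by the monic polynomial of `A`. -/
def divSub (A : Finset (Fin n)) : Submodule F (WordPoly F n) :=
  Submodule.span F {x | ∃ (B : Finset (Fin n)) (w : Word n) (m : ℕ),
    A ⊆ B ∧ Free B w.1 ∧ x = wordGen F B w m}

variable {F}

@[simp] lemma shift_single (m : ℕ) (x : WordSpace F n) :
    shift F (Finsupp.single m x) = Finsupp.single (m + 1) x := by
  simp [shift]

@[simp] lemma shift_apply_succ (x : WordPoly F n) (m : ℕ) : shift F x (m + 1) = x m := by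
  simp only [shift, Finsupp.lmapDomain_apply]
  exact Finsupp.mapDomain_apply Nat.succ_injective x m

@[simp] lemma shift_apply_zero (x : WordPoly F n) : shift F x 0 = 0 := by
  simp only [shift, Finsupp.lmapDomain_apply]
  exact Finsupp.mapDomain_of_notMem_range _ _ (by simp)

lemma wordGen_mem {A B : Finset (Fin n)} (h : A ⊆ B) {w : Word n} (hw : Free B w.1) (m : ℕ) :
    wordGen F B w m ∈ divSub F A :=
  Submodule.subset_span ⟨B, w, m, h, hw, rfl⟩

lemma divSub_anti {A B : Finset (Fin n)} (h : A ⊆ B) : divSub F B ≤ divSub F A :=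
  Submodule.span_mono fun _ ⟨C, w, m, hC, hw, hx⟩ => ⟨C, w, m, h.trans hC, hw, hx⟩

lemma shift_wordGen (B : Finset (Fin n)) (w : Word n) (m : ℕ) :
    shift F (wordGen F B w m) = wordGen F B w (m + 1) := by
  simp only [wordGen, map_sum, shift_single]
  refine Finset.sum_congr rfl fun s _ => ?_
  congr 1
  omega

lemma shift_mem {A : Finset (Fin n)} {x : WordPoly F n} (hx : x ∈ divSub F A) :
    shift F x ∈ divSub F A := by
  have : divSub F A ≤ (divSub F A).comap (shift F) := by
    refine Submodule.span_le.2 ?_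
    rintro _ ⟨B, w, m, hB, hw, rfl⟩
    simpa [shift_wordGen] using wordGen_mem hB hw (m + 1)
  exact this hx

/-- The polynomials of degree less than `a`. -/
def lowSub (F : Type*) [Field F] {n : ℕ} (a : ℕ) : Submodule F (WordPoly F n) where
  carrier := {x | ∀ m, a ≤ m → x m = 0}
  add_mem' hx hy m hm := by simp [hx m hm, hy m hm]
  zero_mem' m _ := rfl
  smul_mem' c x hx m hm := by simp [hx m hm]

/-- For m ≥ |A|, u t^m is the leading term of t^(m-|A|) u P_A. The other terms have lower degree and
words ending in (A, s) with s ≥ 1, which are again free for A. -/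
lemma single_vec_mem_of_free (A : Finset (Fin n)) (m : ℕ) :
    ∀ u : Word n, Free A u.1 →
      (Finsupp.single m (vec F u) : WordPoly F n) ∈ divSub F A ⊔ lowSub F A.card := by
  induction m using Nat.strong_induction_on with
  | _ m ih =>
    intro u hu
    by_cases hm : m < A.card
    · refine Submodule.mem_sup_right fun k hk => ?_
      rw [Finsupp.single_apply, if_neg (by omega)]
    · have h := wordGen_mem (F := F) (Finset.Subset.refl A) hu (m - A.card)
      rw [wordGen, Finset.sum_range_succ', Word.extend_zero, Nat.sub_zero,
        Nat.sub_add_cancel (not_lt.1 hm)] at h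
      refine (Submodule.add_mem_iff_right (divSub F A ⊔ lowSub F A.card) ?_).1 (Submodule.mem_sup_left (T := lowSub F A.card) h)
      refine Submodule.sum_mem _ fun s hs => ?_
      have hs := Finset.mem_range.1 hs
      exact ih _ (by omega) _ (Word.free_extend (by omega) (by omega) hu (by omega))

/-- A word not free for A is w(B, j) with A ⊆ B and |B| - j = |A|, so for m ≥ |A| u t^m is the term
s = j of t^(m-|A|) w P_B. The other terms may have higher degree, but their words are free for A or
equal to the shorter w; hence the induction on length, uniform in m. -/
lemma single_vec_mem (A : Finset (Fin n)) (l : ℕ) :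
    ∀ u : Word n, u.1.length = l → ∀ m,
      (Finsupp.single m (vec F u) : WordPoly F n) ∈ divSub F A ⊔ lowSub F A.card := by
  induction l with
  | zero =>
    intro u hu m
    refine single_vec_mem_of_free A m u ?_
    rw [List.length_eq_zero_iff.1 hu]
    trivial
  | succ l ih =>
    intro u hu m
    rcases Word.free_or_exists A u with h | ⟨B, j, w, hw, hj, hAB, hc, rfl, hlen⟩
    · exact single_vec_mem_of_free A m u h
    by_cases hm : m < A.card
    · refine Submodule.mem_sup_right fun k hk => ?_
      rw [Finsupp.single_apply, if_neg (by omega)]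
    have h := wordGen_mem (F := F) hAB hw (m - A.card)
    rw [wordGen, ← Finset.add_sum_erase _ _ (Finset.mem_range.2 (by omega : j < B.card + 1)),
      show m - A.card + (B.card - j) = m by omega] at h
    refine (Submodule.add_mem_iff_left (divSub F A ⊔ lowSub F A.card) ?_).1 (Submodule.mem_sup_left (T := lowSub F A.card) h)
    refine Submodule.sum_mem _ fun s hs => ?_
    simp only [Finset.mem_erase, Finset.mem_range] at hs
    rcases Nat.eq_zero_or_pos s with rfl | h0
    · rw [Word.extend_zero]
      exact ih _ (by omega) _
    · exact single_vec_mem_of_free A _ _ (Word.free_extend h0 (by omega) hw (by omega))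

lemma divSub_sup_lowSub (A : Finset (Fin n)) : divSub F A ⊔ lowSub F A.card = ⊤ := by
  refine eq_top_iff.2 fun x _ => ?_
  induction x using Finsupp.induction_linear with
  | zero => exact zero_mem _
  | add x y hx hy => exact add_mem (hx trivial) (hy trivial)
  | single m y =>
    induction y using Finsupp.induction_linear with
    | zero => simp
    | add x y hx hy => rw [Finsupp.single_add]; exact add_mem (hx trivial) (hy trivial)
    | single u c =>
      have := Submodule.smul_mem _ c (single_vec_mem (F := F) A _ u rfl m)
      simpa using this

lemma wordGen_apply_apply (B : Finset (Fin n)) (w : Word n) (m k : ℕ) (u : Word n)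
    (h : wordGen F B w m k u ≠ 0) : ∃ s ≤ B.card, m + (B.card - s) = k ∧ w.extend B s = u := by
  by_contra! hne
  refine h ?_
  simp only [wordGen, Finsupp.finsetSum_apply]
  refine Finset.sum_eq_zero fun s hs => ?_
  have hs := Finset.mem_range.1 hs
  by_cases hk : m + (B.card - s) = k
  · rw [hk, Finsupp.single_eq_same, Finsupp.single_apply, if_neg (hne s (by omega) hk)]
  · rw [Finsupp.single_apply, if_neg hk, Finsupp.zero_apply]

lemma wordGen_apply {B : Finset (Fin n)} (w : Word n) (m : ℕ) {s : ℕ} (hs : s ≤ B.card) :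
    wordGen F B w m (m + (B.card - s)) = vec F (w.extend B s) := by
  simp only [wordGen, Finsupp.finsetSum_apply]
  rw [Finset.sum_eq_single_of_mem s (Finset.mem_range.2 (by omega))]
  · simp
  · intro s' hs' hne
    have hs' := Finset.mem_range.1 hs'
    rw [Finsupp.single_apply, if_neg (by omega)]

lemma wordGen_apply_of_lt {B : Finset (Fin n)} (w : Word n) (m : ℕ) {k : ℕ} (hk : m + B.card < k) :
    wordGen F B w m k = 0 := by
  simp only [wordGen, Finsupp.finsetSum_apply]
  refine Finset.sum_eq_zero fun s _ => ?_
  rw [Finsupp.single_apply, if_neg (by omega)]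

open Classical in
/-- The generators of `divSub F A` are ordered by this rank. -/
def genRank (A : Finset (Fin n)) (p : ℕ × Finset (Fin n) × Word n) : ℕ ×ₗ ℕ :=
  toLex (if p.2.1 = A then 0 else 1 + p.2.2.1.length, p.1)

/-- Triangularity: the generator t^m w P_B is marked by its term of degree m + |A|, whose word is
w(B, |B|-|A|), or w itself if B = A. A generator can contain another one's mark only if that other
generator has smaller rank. -/
lemma genRank_lt {A B B' : Finset (Fin n)} {w w' : Word n} {m m' : ℕ} (hB : A ⊆ B) (hB' : A ⊆ B')
    (hw : Free B w.1) (hw' : Free B' w'.1)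
    (h : wordGen F B w m (m' + A.card) (w'.extend B' (B'.card - A.card)) ≠ 0) :
    (m', B', w') = (m, B, w) ∨ genRank A (m', B', w') < genRank A (m, B, w) := by
  obtain ⟨s, hs, hm, hu⟩ := wordGen_apply_apply _ _ _ _ _ h
  have hc := Finset.card_le_card hB
  have hc' := Finset.card_le_card hB'
  simp only [genRank, Prod.Lex.toLex_lt_toLex]
  by_cases hA' : B' = A
  · subst hA'
    rw [Nat.sub_self, Word.extend_zero] at hu
    by_cases hA : B = B'
    · subst hA
      rcases Nat.eq_zero_or_pos s with rfl | h0
      · left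
        rw [Word.extend_zero] at hu
        rw [hu, show m = m' by omega]
      · right
        right
        simp
        omega
    · right
      left
      simp [hA]
  · have hlt : A.card < B'.card := Finset.card_lt_card (lt_of_le_of_ne hB' (Ne.symm hA'))
    have hu := congrArg Subtype.val hu
    rw [Word.extend_val (w := w') (by omega) (by omega) hw'] at hu
    rcases Nat.eq_zero_or_pos s with rfl | h0
    · rw [Word.extend_zero] at hu
      have hA : B ≠ A := by
        rintro rfl
        rw [hu] at hw
        exact hw ⟨hB', by omega⟩
      right
      left
      simp [hA, hA', hu]
    · left
      rw [Word.extend_val h0 hs hw] at hu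
      simp only [List.cons.injEq, Prod.mk.injEq] at hu
      obtain ⟨⟨rfl, rfl⟩, h3⟩ := hu
      rw [Subtype.ext h3, show m = m' by omega]

/-- In a nontrivial combination of generators, the mark of a generator of maximal rank cannot
cancel, and it sits in degree at least |A|. -/
lemma divSub_inf_lowSub {A : Finset (Fin n)} {x : WordPoly F n} (hx : x ∈ divSub F A)
    (hl : x ∈ lowSub F A.card) : x = 0 := by
  let ι := {p : ℕ × Finset (Fin n) × Word n // A ⊆ p.2.1 ∧ Free p.2.1 p.2.2.1}
  let g : ι → WordPoly F n := fun p => wordGen F p.1.2.1 p.1.2.2 p.1.1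
  have hx' : x ∈ Submodule.span F (Set.range g) := by
    refine Submodule.span_mono ?_ hx
    rintro _ ⟨B, w, m, hB, hw, rfl⟩
    exact ⟨⟨(m, B, w), hB, hw⟩, rfl⟩
  obtain ⟨c, rfl⟩ := (Finsupp.mem_span_range_iff_exists_finsupp).1 hx'
  suffices c = 0 by simp [this]
  by_contra hne
  obtain ⟨i, hi, hmax⟩ := Finset.exists_max_image c.support (fun p => genRank A p.1)
    (Finsupp.support_nonempty_iff.2 hne)
  have h0 := DFunLike.congr_fun (hl (i.1.1 + A.card) (by omega))
    (i.1.2.2.extend i.1.2.1 (i.1.2.1.card - A.card))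
  rw [Finsupp.sum, Finsupp.finsetSum_apply, Finsupp.finsetSum_apply,
    Finset.sum_eq_single_of_mem i hi] at h0
  · have hc := Finset.card_le_card i.2.1
    have := wordGen_apply (F := F) (B := i.1.2.1) i.1.2.2 i.1.1
      (s := i.1.2.1.card - A.card) (by omega)
    rw [show i.1.2.1.card - (i.1.2.1.card - A.card) = A.card by omega] at this
    simp only [g, Finsupp.smul_apply, this] at h0
    simp at h0
    exact Finsupp.mem_support_iff.1 hi h0
  · intro p hp hpi
    by_contra hne'
    have : wordGen F p.1.2.1 p.1.2.2 p.1.1 (i.1.1 + A.card)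
        (i.1.2.2.extend i.1.2.1 (i.1.2.1.card - A.card)) ≠ 0 := by
      intro h
      exact hne' (by simp [g, h])
    rcases genRank_lt p.2.1 i.2.1 p.2.2 i.2.2 this with h | h
    · exact hpi (Subtype.ext h.symm)
    · exact absurd h (not_lt.2 (hmax p hp))

/-! ### The action of P_A and v(A) on words -/

lemma exists_monicAct (A : Finset (Fin n)) (w : Word n) :
    ∃ y ∈ divSub F A, y A.card = vec F w ∧ ∀ m, A.card < m → y m = 0 := by
  have h : (Finsupp.single A.card (vec F w) : WordPoly F n) ∈ divSub F A ⊔ lowSub F A.card := by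
    rw [divSub_sup_lowSub]
    trivial
  obtain ⟨y, hy, z, hz, hyz⟩ := Submodule.mem_sup.1 h
  refine ⟨y, hy, ?_, fun m hm => ?_⟩
  · have := DFunLike.congr_fun hyz A.card
    simpa [hz A.card le_rfl] using this
  · have := DFunLike.congr_fun hyz m
    rw [Finsupp.single_apply, if_neg (by omega)] at this
    simpa [hz m hm.le] using this

variable (F) in
/-- The action of the monic polynomial of `A` on the space of words. -/
def monicAct (A : Finset (Fin n)) : WordSpace F n →ₗ[F] WordPoly F n :=
  Finsupp.linearCombination F fun w => (exists_monicAct (F := F) A w).choose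

lemma monicAct_spec (A : Finset (Fin n)) (x : WordSpace F n) :
    monicAct F A x ∈ divSub F A ∧ monicAct F A x A.card = x ∧
      ∀ m, A.card < m → monicAct F A x m = 0 := by
  induction x using Finsupp.induction_linear with
  | zero => simp
  | add x y hx hy =>
    rw [map_add]
    refine ⟨add_mem hx.1 hy.1, ?_, fun m hm => ?_⟩
    · rw [Finsupp.add_apply, hx.2.1, hy.2.1]
    · rw [Finsupp.add_apply, hx.2.2 m hm, hy.2.2 m hm, add_zero]
  | single w c =>
    obtain ⟨h1, h2, h3⟩ := (exists_monicAct (F := F) A w).choose_spec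
    rw [monicAct, Finsupp.linearCombination_single]
    refine ⟨Submodule.smul_mem _ _ h1, ?_, fun m hm => ?_⟩
    · rw [Finsupp.smul_apply, h2]
      simp
    · rw [Finsupp.smul_apply, h3 m hm, smul_zero]

lemma eq_monicAct {A : Finset (Fin n)} {x : WordPoly F n} (hx : x ∈ divSub F A)
    (h : ∀ m, A.card < m → x m = 0) : x = monicAct F A (x A.card) := by
  obtain ⟨h1, h2, h3⟩ := monicAct_spec A (x A.card)
  refine sub_eq_zero.1 (divSub_inf_lowSub (Submodule.sub_mem _ hx h1) fun m hm => ?_)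
  rcases hm.eq_or_lt with rfl | hm
  · rw [Finsupp.sub_apply, h2, sub_self]
  · rw [Finsupp.sub_apply, h m hm, h3 m hm, sub_self]

lemma monicAct_vec {A : Finset (Fin n)} {w : Word n} (hw : Free A w.1) :
    monicAct F A (vec F w) = wordGen F A w 0 := by
  have h := eq_monicAct (wordGen_mem (F := F) (Finset.Subset.refl A) hw 0)
    (fun m hm => wordGen_apply_of_lt w 0 (by omega))
  have h0 := wordGen_apply (F := F) (B := A) w 0 (Nat.zero_le _)
  rw [Nat.sub_zero, zero_add, Word.extend_zero] at h0
  rw [h, h0]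

lemma monicAct_vec_apply {A : Finset (Fin n)} {w : Word n} (hw : Free A w.1) {k : ℕ}
    (hk : k ≤ A.card) : monicAct F A (vec F w) (A.card - k) = vec F (w.extend A k) := by
  rw [monicAct_vec hw, ← wordGen_apply (F := F) w 0 hk, zero_add]

variable (F) in
/-- The action of `v(A)` on the space of words. -/
def vAct (A : Finset (Fin n)) : WordSpace F n →ₗ[F] WordSpace F n :=
  -(Finsupp.lapply A.card ∘ₗ shift F ∘ₗ monicAct F A)

lemma vAct_apply (A : Finset (Fin n)) (x : WordSpace F n) :
    vAct F A x = -(shift F (monicAct F A x) A.card) := rfl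

/-- Reading degree |A| after a shift gives the subleading coefficient, and gives 0 for A = ∅, where
a truncated |A| - 1 would wrongly read the leading one. -/
lemma vAct_empty : vAct F (∅ : Finset (Fin n)) = 0 := by
  refine LinearMap.ext fun x => ?_
  simp [vAct_apply]

/-- Both x P_A and t x P_{A\i} are multiples of P_{A\i} with the same coefficient in degree |A|.
Their difference has degree at most |A| - 1, so uniqueness identifies it as y P_{A\i}, with y read
off from the subleading coefficients. -/
lemma monicAct_step {A : Finset (Fin n)} {i : Fin n} (hi : i ∈ A) (x : WordSpace F n) :
    monicAct F A x = shift F (monicAct F (A.erase i) x)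
      - monicAct F (A.erase i) (vAct F A x - vAct F (A.erase i) x) := by
  obtain ⟨h1, h2, h3⟩ := monicAct_spec A x
  obtain ⟨h1', h2', h3'⟩ := monicAct_spec (A.erase i) x
  have hc := Finset.card_erase_add_one hi
  have key := eq_monicAct (A := A.erase i)
    (x := monicAct F A x - shift F (monicAct F (A.erase i) x))
    (Submodule.sub_mem _ (divSub_anti (Finset.erase_subset i A) h1) (shift_mem h1')) (fun m hm => by
      obtain ⟨k, rfl⟩ := Nat.exists_eq_add_of_lt hm
      rw [Finsupp.sub_apply, shift_apply_succ]
      rcases Nat.eq_zero_or_pos k with rfl | hk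
      · rw [add_zero, h2', hc, h2, sub_self]
      · rw [h3 _ (by omega), h3' _ (by omega), sub_self])
  have hv : (monicAct F A x - shift F (monicAct F (A.erase i) x)) (A.erase i).card
      = -(vAct F A x - vAct F (A.erase i) x) := by
    rw [vAct_apply, vAct_apply, Finsupp.sub_apply, ← hc, shift_apply_succ]
    abel
  rw [hv, map_neg] at key
  rw [sub_eq_iff_eq_add.1 key]
  abel

/-- Expanding x P_A down to C = A \ {i, j} in the two possible orders gives the same polynomial. The
t² and t terms agree, so the constant factors agree after multiplication by P_C, and the coefficient
of t^|C| recovers them. -/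
lemma vAct_rel {A : Finset (Fin n)} {i j : Fin n} (hi : i ∈ A) (hj : j ∈ A) (hij : i ≠ j)
    (x : WordSpace F n) :
    (vAct F (A.erase i) (vAct F A x) - vAct F (A.erase i) (vAct F (A.erase i) x)
      + vAct F ((A.erase i).erase j) (vAct F (A.erase i) x))
    - (vAct F (A.erase j) (vAct F A x) - vAct F (A.erase j) (vAct F (A.erase j) x)
      + vAct F ((A.erase j).erase i) (vAct F (A.erase j) x)) = 0 := by
  have h1 := monicAct_step hi x
  have h2 := monicAct_step hj x
  have hji : j ∈ A.erase i := Finset.mem_erase.2 ⟨hij.symm, hj⟩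
  have hij' : i ∈ A.erase j := Finset.mem_erase.2 ⟨hij, hi⟩
  rw [monicAct_step hji x, monicAct_step hji] at h1
  rw [monicAct_step hij' x, monicAct_step hij', Finset.erase_right_comm] at h2
  rw [Finset.erase_right_comm (a := j)]
  set C := (A.erase i).erase j
  rw [h1] at h2
  have h3 := (monicAct_spec C (vAct F (A.erase i) (vAct F A x - vAct F (A.erase i) x)
    - vAct F C (vAct F A x - vAct F (A.erase i) x))).2.1
  have h4 := (monicAct_spec C (vAct F (A.erase j) (vAct F A x - vAct F (A.erase j) x)
    - vAct F C (vAct F A x - vAct F (A.erase j) x))).2.1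
  have h5 : monicAct F C (vAct F (A.erase i) (vAct F A x - vAct F (A.erase i) x)
      - vAct F C (vAct F A x - vAct F (A.erase i) x))
      = monicAct F C (vAct F (A.erase j) (vAct F A x - vAct F (A.erase j) x)
      - vAct F C (vAct F A x - vAct F (A.erase j) x)) := by
    simp only [map_sub] at h2 ⊢
    linear_combination (norm := module) h2
  have h6 := h3.symm.trans ((DFunLike.congr_fun h5 C.card).trans h4)
  simp only [map_sub] at h6
  rw [← sub_eq_zero] at h6
  rw [← h6]
  abel

end WordModule

/-! ### The polynomials P_A over Q_n -/

section QuotientAlgebra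

open Polynomial

/-- The roots on each side sum to a - d by telescoping, and their products agree exactly by the
relation. -/
lemma linear_factors_swap {R : Type*} [Ring R] {a b c d : R}
    (h : (a * b - b ^ 2 + b * d) - (a * c - c ^ 2 + c * d) = 0) :
    (X - C (a - b)) * (X - C (b - d)) = (X - C (a - c)) * (X - C (c - d)) := by
  have hmul : ∀ x y : R, (X - C x) * (X - C y) = X * X - C (x + y) * X + C (x * y) := by
    intro x y
    rw [mul_sub, sub_mul, sub_mul, X_mul_C, ← C_mul, C_add, add_mul]
    abel
  have h' : (a - b) * (b - d) = (a - c) * (c - d) := by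
    rw [← sub_eq_zero, ← h]
    noncomm_ring
  rw [hmul, hmul, h', sub_add_sub_cancel, sub_add_sub_cancel]

/-- The ring structure of `Q_n` whose semiring structure is the given one by definition. -/
instance Q.instRing (F : Type*) [Field F] (n : ℕ) : Ring (Q F n) := Algebra.semiringToRing F

instance Q.instSub (F : Type*) [Field F] (n : ℕ) : Sub (Q F n) := (Q.instRing F n).toSub

instance Q.instNeg (F : Type*) [Field F] (n : ℕ) : Neg (Q F n) := (Q.instRing F n).toNeg

instance Q.instAddCommGroup (F : Type*) [Field F] (n : ℕ) : AddCommGroup (Q F n) :=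
  (Q.instRing F n).toAddCommGroup

variable (F : Type*) [Field F] {n : ℕ}

/-- The image of `v(A)` in `Q_n`. -/
def vQ (A : Finset (Fin n)) : Q F n := RingQuot.mkAlgHom F (Rel F n) (v F A)

lemma vQ_empty : vQ F (∅ : Finset (Fin n)) = 0 := by
  simp [vQ, v]

variable {F}

lemma vQ_rel {A : Finset (Fin n)} {i j : Fin n} (hi : i ∈ A) (hj : j ∈ A) (hij : i ≠ j) :
    (vQ F A * vQ F (A.erase i) - vQ F (A.erase i) ^ 2
      + vQ F (A.erase i) * vQ F ((A.erase i).erase j))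
    - (vQ F A * vQ F (A.erase j) - vQ F (A.erase j) ^ 2
      + vQ F (A.erase j) * vQ F ((A.erase j).erase i)) = 0 := by
  have h := RingQuot.mkAlgHom_rel F (Rel.quad (F := F) A i j hi hj hij)
  simpa only [vQ, quadElt, map_sub, map_add, map_mul, map_pow, map_zero] using h

variable (F) in
/-- The product of the linear factors along the chain of subsets given by a list. -/
def monicList : List (Fin n) → (Q F n)[X]
  | [] => 1
  | i :: l => (X - C (vQ F (i :: l).toFinset - vQ F l.toFinset)) * monicList l

/-- Adjacent transpositions suffice, and each is one instance of the defining relation; distinctness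
of the entries makes the relation applicable. -/
lemma monicList_perm {l₁ l₂ : List (Fin n)} (h : l₁.Perm l₂) (hn : l₁.Nodup) :
    monicList F l₁ = monicList F l₂ := by
  induction h with
  | nil => rfl
  | @cons i l l' h ih =>
    rw [monicList, monicList, ih hn.of_cons, List.toFinset_eq_of_perm _ _ h,
      List.toFinset_eq_of_perm _ _ (h.cons i)]
  | swap i j l =>
    have hji : j ≠ i := fun h => by simp [h] at hn
    have hj : j ∉ l := fun h => by simp [h] at hn
    have hi : i ∉ l := fun h => by simp [h] at hn
    have h := vQ_rel (F := F) (A := (j :: i :: l).toFinset) (i := j) (j := i) (by simp) (by simp)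
      hji
    have e1 : (j :: i :: l).toFinset.erase j = (i :: l).toFinset := by
      ext x; simp only [Finset.mem_erase, List.mem_toFinset, List.mem_cons]; grind
    have e2 : (j :: i :: l).toFinset.erase i = (j :: l).toFinset := by
      ext x; simp only [Finset.mem_erase, List.mem_toFinset, List.mem_cons]; grind
    have e3 : (i :: l).toFinset.erase i = l.toFinset := by
      ext x; simp only [Finset.mem_erase, List.mem_toFinset, List.mem_cons]; grind
    have e4 : (j :: l).toFinset.erase j = l.toFinset := by
      ext x; simp only [Finset.mem_erase, List.mem_toFinset, List.mem_cons]; grind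
    have e5 : (i :: j :: l).toFinset = (j :: i :: l).toFinset :=
      List.toFinset_eq_of_perm _ _ (List.Perm.swap j i l)
    rw [e1, e2, e3, e4] at h
    simp only [monicList, ← mul_assoc]
    rw [e5, linear_factors_swap h]
  | trans h₁ _ ih₁ ih₂ => exact (ih₁ hn).trans (ih₂ (h₁.nodup_iff.1 hn))

variable (F) in
/-- The monic polynomial of degree `|A|` over `Q_n` attached to `A`. -/
def monicPoly (A : Finset (Fin n)) : (Q F n)[X] := monicList F A.toList

lemma monicPoly_empty : monicPoly F (∅ : Finset (Fin n)) = 1 := by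
  simp [monicPoly, monicList]

lemma monicPoly_insert {A : Finset (Fin n)} {i : Fin n} (hi : i ∉ A) :
    monicPoly F (insert i A) = (X - C (vQ F (insert i A) - vQ F A)) * monicPoly F A := by
  rw [monicPoly, monicList_perm (Finset.toList_insert hi) (Finset.nodup_toList _), monicList,
    List.toFinset_cons, Finset.toList_toFinset, monicPoly]

lemma exists_eq_mul_monicPoly {A B : Finset (Fin n)} (h : A ⊆ B) :
    ∃ r, monicPoly F B = r * monicPoly F A := by
  rw [← Finset.union_sdiff_of_subset h]
  generalize B \ A = D
  induction D using Finset.induction_on with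
  | empty => exact ⟨1, by rw [Finset.union_empty, one_mul]⟩
  | insert i D hi ih =>
    rw [Finset.union_insert]
    by_cases hiA : i ∈ A ∪ D
    · rwa [Finset.insert_eq_of_mem hiA]
    · obtain ⟨r, hr⟩ := ih
      exact ⟨_, by rw [monicPoly_insert hiA, hr, ← mul_assoc]⟩

lemma coeff_X_sub_C_mul_succ (c : Q F n) (p : (Q F n)[X]) (m : ℕ) :
    ((X - C c) * p).coeff (m + 1) = p.coeff m - c * p.coeff (m + 1) := by
  rw [sub_mul, coeff_sub, coeff_X_mul, coeff_C_mul]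

lemma coeff_X_sub_C_mul_zero (c : Q F n) (p : (Q F n)[X]) :
    ((X - C c) * p).coeff 0 = -(c * p.coeff 0) := by
  rw [sub_mul, coeff_sub, coeff_X_mul_zero, coeff_C_mul, zero_sub]

lemma monicPoly_coeff_of_lt (A : Finset (Fin n)) :
    ∀ m, A.card < m → (monicPoly F A).coeff m = 0 := by
  induction A using Finset.induction_on with
  | empty =>
    intro m hm
    rw [monicPoly_empty, coeff_one, if_neg (by simp at hm; omega)]
  | insert i A hi ih =>
    intro m hm
    rw [Finset.card_insert_of_notMem hi] at hm
    obtain ⟨k, rfl⟩ : ∃ k, m = k + 1 := ⟨m - 1, by omega⟩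
    rw [monicPoly_insert hi, coeff_X_sub_C_mul_succ, ih _ (by omega), ih _ (by omega), mul_zero,
      sub_zero]

lemma monicPoly_coeff_card (A : Finset (Fin n)) : (monicPoly F A).coeff A.card = 1 := by
  induction A using Finset.induction_on with
  | empty => rw [monicPoly_empty, Finset.card_empty, coeff_one_zero]
  | insert i A hi ih =>
    rw [Finset.card_insert_of_notMem hi, monicPoly_insert hi, coeff_X_sub_C_mul_succ, ih,
      monicPoly_coeff_of_lt _ _ (by omega), mul_zero, sub_zero]

lemma X_mul_monicPoly_coeff_card (A : Finset (Fin n)) :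
    (X * monicPoly F A).coeff A.card = -vQ F A := by
  induction A using Finset.induction_on with
  | empty => rw [Finset.card_empty, coeff_X_mul_zero, vQ_empty, neg_zero]
  | insert i A hi ih =>
    rw [Finset.card_insert_of_notMem hi, coeff_X_mul, monicPoly_insert hi, sub_mul, coeff_sub, ih,
      coeff_C_mul, monicPoly_coeff_card, mul_one]
    abel

/-! ### Degrees of products and coefficients -/

lemma TVgrade_mul {i j : ℕ} {x y : TV F n} (hx : x ∈ TVgrade F n i) (hy : y ∈ TVgrade F n j) :
    x * y ∈ TVgrade F n (i + j) := by
  have h := Submodule.mul_mem_mul hx hy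
  rw [TVgrade, TVgrade, Submodule.span_mul_span] at h
  refine Submodule.span_mono ?_ h
  rintro _ ⟨_, ⟨w, hw, rfl⟩, _, ⟨w', hw', rfl⟩, rfl⟩
  exact ⟨w ++ w', by simp [hw, hw'], by simp⟩

lemma Qgrade_mul {i j : ℕ} {x y : Q F n} (hx : x ∈ Qgrade F n i) (hy : y ∈ Qgrade F n j) :
    x * y ∈ Qgrade F n (i + j) := by
  obtain ⟨x, hx, rfl⟩ := hx
  obtain ⟨y, hy, rfl⟩ := hy
  exact ⟨x * y, TVgrade_mul hx hy, by simp⟩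

lemma one_mem_Qgrade : (1 : Q F n) ∈ Qgrade F n 0 :=
  ⟨1, Submodule.subset_span ⟨[], rfl, rfl⟩, by simp⟩

lemma vQ_mem_Qgrade (A : Finset (Fin n)) : vQ F A ∈ Qgrade F n 1 := by
  refine ⟨v F A, ?_, rfl⟩
  by_cases h : A.Nonempty
  · rw [v, dif_pos h]
    exact Submodule.subset_span ⟨[⟨A, h⟩], rfl, by simp⟩
  · rw [v, dif_neg h]
    exact zero_mem _

lemma monicPoly_coeff_mem (A : Finset (Fin n)) :
    ∀ m k, m + k = A.card → (monicPoly F A).coeff m ∈ Qgrade F n k := by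
  induction A using Finset.induction_on with
  | empty =>
    intro m k h
    obtain ⟨rfl, rfl⟩ : m = 0 ∧ k = 0 := by simpa using h
    rw [monicPoly_empty, coeff_one_zero]
    exact one_mem_Qgrade
  | insert i A hi ih =>
    intro m k h
    have hv : vQ F (insert i A) - vQ F A ∈ Qgrade F n 1 :=
      Submodule.sub_mem _ (vQ_mem_Qgrade _) (vQ_mem_Qgrade _)
    have key : ∀ m k, m + k = A.card + 1 → (vQ F (insert i A) - vQ F A) * (monicPoly F A).coeff m
        ∈ Qgrade F n k := by
      intro m k h
      rcases Nat.eq_zero_or_pos k with rfl | hk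
      · rw [monicPoly_coeff_of_lt _ _ (by omega), mul_zero]
        exact zero_mem _
      · have := Qgrade_mul hv (ih m (k - 1) (by omega))
        rwa [Nat.add_sub_cancel' hk] at this
    rw [Finset.card_insert_of_notMem hi] at h
    rw [monicPoly_insert hi]
    match m with
    | 0 =>
      rw [coeff_X_sub_C_mul_zero]
      exact Submodule.neg_mem _ (key _ _ h)
    | m + 1 =>
      rw [coeff_X_sub_C_mul_succ]
      exact Submodule.sub_mem _ (ih _ _ (by omega)) (key _ _ h)

/-! ### Evaluation of words in Q_n -/

/-- The element of `Q_n` represented by a word. -/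
def evalWord (F : Type*) [Field F] {n : ℕ} : List (Finset (Fin n) × ℕ) → Q F n
  | [] => 1
  | (A, k) :: w => evalWord F w * (monicPoly F A).coeff (A.card - k)

lemma evalWord_extend {B : Finset (Fin n)} {w : Word n} (hw : Free B w.1) {s : ℕ}
    (hs : s ≤ B.card) :
    evalWord F (w.extend B s).1 = evalWord F w.1 * (monicPoly F B).coeff (B.card - s) := by
  rcases Nat.eq_zero_or_pos s with rfl | h0
  · rw [Word.extend_zero, Nat.sub_zero, monicPoly_coeff_card, mul_one]
  · rw [Word.extend_val h0 hs hw, evalWord]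

/-- The degree of a word. -/
def wordDegree {n : ℕ} (w : List (Finset (Fin n) × ℕ)) : ℕ := (w.map Prod.snd).sum

lemma evalWord_mem (l : List (Finset (Fin n) × ℕ)) (hl : Normal l) :
    evalWord F l ∈ Qgrade F n (wordDegree l) := by
  induction l with
  | nil => exact one_mem_Qgrade
  | cons p l ih =>
    obtain ⟨A, k⟩ := p
    have := Qgrade_mul (ih hl.2.2.2) (monicPoly_coeff_mem (F := F) A (A.card - k) k
      (Nat.sub_add_cancel hl.2.1))
    rwa [wordDegree, List.map_cons, List.sum_cons, add_comm]

variable (F n) in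
/-- The linear map from the space of words to `Q_n`. -/
def evalSpace : WordSpace F n →ₗ[F] Q F n :=
  Finsupp.linearCombination F fun w => evalWord F w.1

variable (F n) in
/-- `evalSpace` extended to polynomials. -/
def evalPoly : WordPoly F n →ₗ[F] (Q F n)[X] :=
  Finsupp.lsum F fun m => ((monomial m).restrictScalars F) ∘ₗ evalSpace F n

lemma evalSpace_vec (w : Word n) : evalSpace F n (vec F w) = evalWord F w.1 := by
  simp [evalSpace]

lemma evalPoly_single (m : ℕ) (x : WordSpace F n) :
    evalPoly F n (Finsupp.single m x) = monomial m (evalSpace F n x) := by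
  simp [evalPoly]

lemma evalPoly_coeff (x : WordPoly F n) (m : ℕ) :
    (evalPoly F n x).coeff m = evalSpace F n (x m) := by
  induction x using Finsupp.induction_linear with
  | zero => simp
  | add x y hx hy => rw [map_add, coeff_add, hx, hy, Finsupp.add_apply, map_add]
  | single k y =>
    rw [evalPoly_single, coeff_monomial, Finsupp.single_apply]
    split_ifs <;> simp

lemma evalPoly_shift (x : WordPoly F n) : evalPoly F n (shift F x) = X * evalPoly F n x := by
  ext m
  cases m with
  | zero => rw [evalPoly_coeff, shift_apply_zero, coeff_X_mul_zero, map_zero]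
  | succ m => rw [evalPoly_coeff, shift_apply_succ, coeff_X_mul, evalPoly_coeff]

lemma evalPoly_wordGen {B : Finset (Fin n)} {w : Word n} (hw : Free B w.1) (m : ℕ) :
    evalPoly F n (wordGen F B w m) = X ^ m * C (evalWord F w.1) * monicPoly F B := by
  induction m with
  | zero =>
    ext k
    rw [evalPoly_coeff, pow_zero, one_mul, coeff_C_mul]
    by_cases hk : k ≤ B.card
    · have := wordGen_apply (F := F) w 0 (Nat.sub_le B.card k)
      rw [Nat.sub_sub_self hk, zero_add] at this
      rw [this, evalSpace_vec, evalWord_extend hw (Nat.sub_le _ _), Nat.sub_sub_self hk]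
    · rw [wordGen_apply_of_lt _ _ (by omega), monicPoly_coeff_of_lt _ _ (by omega), map_zero,
        mul_zero]
  | succ m ih =>
    rw [← shift_wordGen, evalPoly_shift, ih, pow_succ', mul_assoc, mul_assoc, mul_assoc]

lemma exists_evalPoly_eq {A : Finset (Fin n)} {x : WordPoly F n} (hx : x ∈ divSub F A) :
    ∃ r, evalPoly F n x = r * monicPoly F A := by
  refine Submodule.span_induction ?_ ⟨0, by simp⟩ ?_ ?_ hx
  · rintro _ ⟨B, w, m, hB, hw, rfl⟩
    obtain ⟨r, hr⟩ := exists_eq_mul_monicPoly (F := F) hB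
    exact ⟨_, by rw [evalPoly_wordGen hw, hr, ← mul_assoc]⟩
  · rintro x y _ _ ⟨r, hr⟩ ⟨s, hs⟩
    exact ⟨r + s, by rw [map_add, hr, hs, add_mul]⟩
  · rintro c x _ ⟨r, hr⟩
    exact ⟨c • r, by rw [map_smul, hr, smul_mul_assoc]⟩

lemma eq_zero_of_mul_monicPoly {A : Finset (Fin n)} {r : (Q F n)[X]}
    (h : ∀ m, A.card ≤ m → (r * monicPoly F A).coeff m = 0) : r = 0 := by
  by_contra hr
  have := h (r.natDegree + A.card) (by omega)
  rw [coeff_mul_add_eq_of_natDegree_le le_rfl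
    (natDegree_le_iff_coeff_eq_zero.2 (monicPoly_coeff_of_lt A)), monicPoly_coeff_card,
    mul_one] at this
  exact hr (leadingCoeff_eq_zero.1 this)

/-- The formal multiple evaluates to some r P_A. Comparison in degrees at least |A| shows that (r -
x) P_A has degree below |A|, and P_A is monic, so r = x. -/
lemma evalPoly_monicAct (A : Finset (Fin n)) (x : WordSpace F n) :
    evalPoly F n (monicAct F A x) = C (evalSpace F n x) * monicPoly F A := by
  obtain ⟨h1, h2, h3⟩ := monicAct_spec A x
  obtain ⟨r, hr⟩ := exists_evalPoly_eq h1
  have : r - C (evalSpace F n x) = 0 := by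
    refine eq_zero_of_mul_monicPoly (A := A) fun m hm => ?_
    rw [sub_mul, coeff_sub, ← hr, evalPoly_coeff, coeff_C_mul]
    rcases hm.eq_or_lt with rfl | hm
    · rw [h2, monicPoly_coeff_card, mul_one, sub_self]
    · rw [h3 m hm, monicPoly_coeff_of_lt _ _ hm, map_zero, mul_zero, sub_self]
  rw [hr, sub_eq_zero.1 this]

lemma evalSpace_vAct (A : Finset (Fin n)) (x : WordSpace F n) :
    evalSpace F n (vAct F A x) = evalSpace F n x * vQ F A := by
  rw [vAct_apply, map_neg, ← evalPoly_coeff, evalPoly_shift, evalPoly_monicAct, ← mul_assoc,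
    X_mul_C, mul_assoc, coeff_C_mul, X_mul_monicPoly_coeff_card, mul_neg, neg_neg]

/-! ### The right module structure and the basis -/

variable (F n) in
/-- The right action of `T(V)` on the space of words. -/
def actTV : TV F n →ₐ[F] (Module.End F (WordSpace F n))ᵐᵒᵖ :=
  FreeAlgebra.lift F fun A => MulOpposite.op (vAct F A.1)

lemma actTV_v (A : Finset (Fin n)) : actTV F n (v F A) = MulOpposite.op (vAct F A) := by
  by_cases h : A.Nonempty
  · rw [v, dif_pos h, actTV, FreeAlgebra.lift_ι_apply]
  · rw [v, dif_neg h, map_zero, Finset.not_nonempty_iff_eq_empty.1 h, vAct_empty,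
      MulOpposite.op_zero]

variable (F n) in
/-- The right action of `Q_n` on the space of words. -/
def actQ : Q F n →ₐ[F] (Module.End F (WordSpace F n))ᵐᵒᵖ :=
  RingQuot.liftAlgHom F ⟨actTV F n, by
    rintro _ _ ⟨A, i, j, hi, hj, hij⟩
    simp only [quadElt, map_sub, map_add, map_mul, pow_two, map_zero, actTV_v]
    refine MulOpposite.unop_injective (LinearMap.ext fun x => ?_)
    exact vAct_rel hi hj hij x⟩

/-- The right action of an element of `Q_n`, as a function. -/
def act (q : Q F n) : WordSpace F n →ₗ[F] WordSpace F n := (actQ F n q).unop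

lemma act_mul (q r : Q F n) (x : WordSpace F n) : act (q * r) x = act r (act q x) := by
  simp [act]

lemma act_one (x : WordSpace F n) : act (1 : Q F n) x = x := by
  simp [act]

lemma act_sub (q r : Q F n) (x : WordSpace F n) : act (q - r) x = act q x - act r x := by
  simp [act]

lemma act_neg (q : Q F n) (x : WordSpace F n) : act (-q) x = -act q x := by
  simp [act]

lemma act_zero (x : WordSpace F n) : act (0 : Q F n) x = 0 := by
  simp [act]

lemma act_vQ (A : Finset (Fin n)) (x : WordSpace F n) : act (vQ F A) x = vAct F A x := by
  rw [act, actQ, vQ, RingQuot.liftAlgHom_mkAlgHom_apply, actTV_v, MulOpposite.unop_op]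

lemma Q_induction {p : Q F n → Prop} (hc : ∀ c : F, p (algebraMap F _ c))
    (hv : ∀ A : Finset (Fin n), p (vQ F A)) (hadd : ∀ x y, p x → p y → p (x + y))
    (hmul : ∀ x y, p x → p y → p (x * y)) (q : Q F n) : p q := by
  obtain ⟨x, rfl⟩ := RingQuot.mkAlgHom_surjective F (Rel F n) q
  induction x using FreeAlgebra.induction with
  | grade0 c => rw [AlgHom.commutes]; exact hc c
  | grade1 A =>
    have := hv A.1
    rwa [vQ, v, dif_pos A.2] at this
  | mul a b ha hb => rw [map_mul]; exact hmul _ _ ha hb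
  | add a b ha hb => rw [map_add]; exact hadd _ _ ha hb

lemma evalSpace_act (q : Q F n) : ∀ x, evalSpace F n (act q x) = evalSpace F n x * q := by
  induction q using Q_induction with
  | hc c =>
    intro x
    simp [act, Algebra.algebraMap_eq_smul_one]
  | hv A => intro x; rw [act_vQ, evalSpace_vAct]
  | hadd q r hq hr =>
    intro x
    rw [mul_add, ← hq, ← hr, ← map_add]
    simp [act]
  | hmul q r hq hr => intro x; rw [act_mul, hr, hq, mul_assoc]

/-- P_A in Q_n and its formal action obey the same recursion in A, namely `monicPoly_insert` and
`monicAct_step`. -/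
lemma act_monicPoly_coeff (A : Finset (Fin n)) :
    ∀ (m : ℕ) (x : WordSpace F n), act ((monicPoly F A).coeff m) x = monicAct F A x m := by
  induction A using Finset.induction_on with
  | empty =>
    intro m x
    obtain ⟨-, h2, h3⟩ := monicAct_spec (∅ : Finset (Fin n)) x
    rw [monicPoly_empty, coeff_one]
    split_ifs with h
    · rw [act_one, h]
      exact h2.symm
    · rw [act_zero, h3 m (by simp; omega)]
  | insert i A hi ih =>
    intro m x
    have h := monicAct_step (Finset.mem_insert_self i A) x
    rw [Finset.erase_insert hi] at h
    rw [h, monicPoly_insert hi, Finsupp.sub_apply, ← ih]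
    cases m with
    | zero =>
      rw [coeff_X_sub_C_mul_zero, shift_apply_zero, act_neg, act_mul, act_sub, act_vQ, act_vQ,
        zero_sub]
    | succ m =>
      rw [coeff_X_sub_C_mul_succ, shift_apply_succ, act_sub, act_mul, act_sub, act_vQ, act_vQ, ih]

/-- Each letter acts on a word free for it by appending itself, so a normal word is rebuilt from the
empty word letter by letter. -/
lemma act_evalWord (l : List (Finset (Fin n) × ℕ)) (hl : Normal l) :
    act (evalWord F l) (vec F Word.nil) = vec F ⟨l, hl⟩ := by
  induction l with
  | nil => rw [evalWord, act_one]; rfl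
  | cons p l ih =>
    obtain ⟨A, k⟩ := p
    rw [evalWord, act_mul, ih hl.2.2.2, act_monicPoly_coeff,
      monicAct_vec_apply (w := ⟨l, hl.2.2.2⟩) hl.2.2.1 hl.2.1]
    congr 1
    exact Subtype.ext (Word.extend_val (w := ⟨l, hl.2.2.2⟩) hl.1 hl.2.1 hl.2.2.1)

variable (F n) in
/-- The normal words form a basis of `Q_n`. -/
def wordBasis : Module.Basis (Word n) F (Q F n) :=
  Module.Basis.ofRepr
    { toFun := fun q => act q (vec F Word.nil)
      invFun := evalSpace F n
      map_add' := fun q r => by simp [act]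
      map_smul' := fun c q => by simp [act]
      left_inv := fun q => by
        rw [evalSpace_act, evalSpace_vec]
        exact one_mul q
      right_inv := fun x => by
        induction x using Finsupp.induction_linear with
        | zero => rw [map_zero]; exact act_zero _
        | add x y hx hy =>
          conv_rhs => rw [← hx, ← hy]
          simp [act]
        | single w c =>
          have h := act_evalWord (F := F) w.1 w.2
          have hs : (Finsupp.single w c : WordSpace F n) = c • vec F w := by simp
          rw [hs, map_smul, evalSpace_vec]
          conv_rhs => rw [← h]
          simp [act] }

lemma wordBasis_apply (w : Word n) : wordBasis F n w = evalWord F w.1 :=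
  evalSpace_vec w

/-! ### The grading -/

variable (F n) in
/-- The algebra map `Q_n → Q_n[X]`, `v(A) ↦ v(A) X`, which records the grading. -/
def coaction : Q F n →ₐ[F] (Q F n)[X] :=
  RingQuot.liftAlgHom F ⟨FreeAlgebra.lift F fun A => monomial 1 (vQ F A.1), by
    rintro _ _ ⟨A, i, j, hi, hj, hij⟩
    have hv : ∀ B : Finset (Fin n),
        FreeAlgebra.lift F (fun A : NonemptySubset n => (monomial 1 (vQ F A.1) : (Q F n)[X]))
          (v F B) = monomial 1 (vQ F B) := by
      intro B
      by_cases h : B.Nonempty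
      · rw [v, dif_pos h, FreeAlgebra.lift_ι_apply]
      · rw [v, dif_neg h, map_zero, Finset.not_nonempty_iff_eq_empty.1 h, vQ_empty, map_zero]
    simp only [quadElt, map_sub, map_add, map_mul, pow_two, map_zero, hv, monomial_mul_monomial]
    have h := congrArg (monomial (1 + 1)) (vQ_rel (F := F) hi hj hij)
    simpa only [map_sub, map_add, pow_two, map_zero] using h⟩

lemma coaction_of_mem {i : ℕ} {q : Q F n} (hq : q ∈ Qgrade F n i) :
    coaction F n q = monomial i q := by
  obtain ⟨x, hx, rfl⟩ := hq
  simp only [AlgHom.toLinearMap_apply]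
  refine Submodule.span_induction ?_ (by simp) ?_ ?_ hx
  · rintro _ ⟨w, rfl, rfl⟩
    clear hx
    induction w with
    | nil => simp
    | cons A w ih =>
      have hA : RingQuot.mkAlgHom F (Rel F n) (FreeAlgebra.ι F A) = vQ F A.1 := by
        rw [vQ, v, dif_pos A.2]
      have hA' : coaction F n (vQ F A.1) = monomial 1 (vQ F A.1) := by
        conv_lhs => rw [← hA]
        rw [coaction, RingQuot.liftAlgHom_mkAlgHom_apply, FreeAlgebra.lift_ι_apply]
      rw [List.map_cons, List.prod_cons, map_mul, map_mul, ih,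
        hA, hA', monomial_mul_monomial, List.length_cons, add_comm]
  · intro x y _ _ hx hy
    rw [map_add, map_add, hx, hy, map_add]
  · intro c x _ hx
    rw [map_smul, map_smul, hx, smul_monomial]

/-- The coefficient of X^i in the coaction is the projection to degree i. It fixes Q_{n,i} and kills
every basis word of another degree. -/
lemma Qgrade_eq_span (i : ℕ) :
    Qgrade F n i = Submodule.span F (wordBasis F n '' {w | wordDegree w.1 = i}) := by
  refine le_antisymm (fun q hq => ?_) (Submodule.span_le.2 ?_)
  · have h := congrArg (fun p => coeff p i) (coaction_of_mem hq)
    simp only [coeff_monomial_same] at h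
    rw [← h, ← (wordBasis F n).linearCombination_repr q, Finsupp.linearCombination_apply,
      Finsupp.sum, map_sum, finsetSum_coeff]
    refine Submodule.sum_mem _ fun w _ => ?_
    have hw := evalWord_mem (F := F) w.1 w.2
    rw [← wordBasis_apply] at hw
    rw [map_smul, coeff_smul, coaction_of_mem hw, coeff_monomial]
    split_ifs with h
    · exact Submodule.smul_mem _ _ (Submodule.subset_span ⟨w, h, rfl⟩)
    · rw [smul_zero]
      exact zero_mem _
  · rintro _ ⟨w, rfl, rfl⟩
    rw [wordBasis_apply]
    exact evalWord_mem w.1 w.2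

lemma Qgrade_isInternal : DirectSum.IsInternal (Qgrade F n) := by
  refine DirectSum.isInternal_submodule_of_iSupIndep_of_iSup_eq_top ?_ ?_
  · rw [iSupIndep_def]
    intro i
    rw [Submodule.disjoint_def]
    intro x hx hx'
    have h : (⨆ j, ⨆ (_ : j ≠ i), Qgrade F n j) ≤
        LinearMap.ker (((lcoeff (Q F n) i).restrictScalars F) ∘ₗ (coaction F n).toLinearMap) := by
      refine iSup₂_le fun j hj y hy => ?_
      simp [coaction_of_mem hy, coeff_monomial, hj]
    have := h hx'
    simpa [coaction_of_mem hx] using this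
  · rw [eq_top_iff, ← (wordBasis F n).span_eq, Submodule.span_le]
    rintro _ ⟨w, rfl⟩
    rw [wordBasis_apply]
    exact Submodule.mem_iSup_of_mem _ (evalWord_mem w.1 w.2)

lemma finrank_Qgrade (i : ℕ) :
    Module.finrank F (Qgrade F n i) = {w : Word n | wordDegree w.1 = i}.ncard := by
  rw [Qgrade_eq_span, Set.image_eq_range]
  have h := (wordBasis F n).linearIndependent.comp
    (Subtype.val : {w : Word n | wordDegree w.1 = i} → Word n) Subtype.val_injective
  exact Module.finrank_eq_nat_card_basis (Module.Basis.span h)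

end QuotientAlgebra

/-! ### Counting normal words -/

section Counting

variable {n : ℕ}

lemma Word.eq_nil_or_extend (u : Word n) :
    u = Word.nil ∨ ∃ (A : Finset (Fin n)) (k : ℕ) (w : Word n), 1 ≤ k ∧ k ≤ A.card ∧ Free A w.1 ∧
      u = w.extend A k := by
  obtain ⟨l, hl⟩ := u
  match l, hl with
  | [], _ => exact Or.inl rfl
  | (A, k) :: w, hl =>
    exact Or.inr ⟨A, k, ⟨w, hl.2.2.2⟩, hl.1, hl.2.1, hl.2.2.1,
      Subtype.ext (Word.extend_val (w := ⟨w, hl.2.2.2⟩) hl.1 hl.2.1 hl.2.2.1).symm⟩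

lemma wordDegree_cons (p : Finset (Fin n) × ℕ) (l : List (Finset (Fin n) × ℕ)) :
    wordDegree (p :: l) = p.2 + wordDegree l := by
  simp [wordDegree]

lemma finite_wordDegree_eq (d : ℕ) : {w : Word n | wordDegree w.1 = d}.Finite := by
  induction d using Nat.strong_induction_on with
  | _ d ih =>
    have h : ({Word.nil} ∪ ⋃ A : Finset (Fin n), ⋃ k ∈ Finset.Icc 1 d,
        Word.extend A k '' {w : Word n | wordDegree w.1 = d - k}).Finite := by
      refine (Set.finite_singleton _).union (Set.finite_iUnion fun A => ?_)
      refine (Finset.Icc 1 d).finite_toSet.biUnion fun k hk => (ih _ ?_).image _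
      have := Finset.mem_Icc.1 hk
      omega
    refine h.subset fun u hu => ?_
    rcases Word.eq_nil_or_extend u with rfl | ⟨A, k, w, h1, h2, h3, rfl⟩
    · exact Or.inl rfl
    · rw [Set.mem_ofPred_eq, Word.extend_val h1 h2 h3, wordDegree_cons] at hu
      refine Or.inr (Set.mem_iUnion.2 ⟨A, Set.mem_iUnion₂.2 ⟨k, ?_, w, ?_, rfl⟩⟩)
      · rw [Finset.mem_Icc]
        simp only at hu
        omega
      · simp only [Set.mem_ofPred_eq] at hu ⊢
        omega

/-- The finite set of normal words of degree `d`. -/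
def words (n d : ℕ) : Finset (Word n) := (finite_wordDegree_eq d).toFinset

lemma mem_words {d : ℕ} {w : Word n} : w ∈ words n d ↔ wordDegree w.1 = d := by
  simp [words]

open Classical in
/-- The number of normal words of degree `d` that may be followed by a letter `(A, k)`. -/
def freeCount (A : Finset (Fin n)) (d : ℕ) : ℕ := ((words n d).filter fun w => Free A w.1).card

/-- Deleting the last letter, which is the list head, is a bijection onto words free for A of degree
d - k. -/
lemma card_filter_head (A : Finset (Fin n)) {k : ℕ} (h1 : 1 ≤ k) (h2 : k ≤ A.card) (d : ℕ) :
    ((words n d).filter fun w => w.1.head? = some (A, k)).card =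
      if k ≤ d then freeCount A (d - k) else 0 := by
  classical
  split_ifs with hd
  · rw [freeCount]
    symm
    refine Finset.card_bij (fun w _ => w.extend A k) ?_ ?_ ?_
    · intro w hw
      obtain ⟨hw, hf⟩ := Finset.mem_filter.1 hw
      rw [Finset.mem_filter, mem_words, Word.extend_val h1 h2 hf, wordDegree_cons, mem_words.1 hw]
      exact ⟨Nat.add_sub_cancel' hd, rfl⟩
    · intro w hw w' hw' h
      have hf := (Finset.mem_filter.1 hw).2
      have hf' := (Finset.mem_filter.1 hw').2
      have h := congrArg Subtype.val h
      rw [Word.extend_val h1 h2 hf, Word.extend_val h1 h2 hf'] at h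
      exact Subtype.ext (List.cons.inj h).2
    · intro u hu
      obtain ⟨hd', hh⟩ := Finset.mem_filter.1 hu
      clear hu
      rcases Word.eq_nil_or_extend u with rfl | ⟨B, j, w, h1', h2', h3, rfl⟩
      · simp [Word.nil] at hh
      · rw [Word.extend_val h1' h2' h3, List.head?_cons, Option.some.injEq, Prod.mk.injEq] at hh
        obtain ⟨rfl, rfl⟩ := hh
        rw [mem_words, Word.extend_val h1' h2' h3, wordDegree_cons] at hd'
        refine ⟨w, Finset.mem_filter.2 ⟨mem_words.2 ?_, h3⟩, rfl⟩
        simp only at hd'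
        omega
  · rw [Finset.card_eq_zero, Finset.filter_eq_empty_iff]
    intro u hu hh
    rcases Word.eq_nil_or_extend u with rfl | ⟨B, j, w, h1', h2', h3, rfl⟩
    · simp [Word.nil] at hh
    · rw [Word.extend_val h1' h2' h3, List.head?_cons, Option.some.injEq, Prod.mk.injEq] at hh
      obtain ⟨rfl, rfl⟩ := hh
      rw [mem_words, Word.extend_val h1' h2' h3, wordDegree_cons] at hu
      simp only at hu
      omega

lemma card_words (d : ℕ) : (words n d).card = (if d = 0 then 1 else 0) +
    ∑ A : Finset (Fin n), ∑ k ∈ Finset.Icc 1 A.card, if k ≤ d then freeCount A (d - k) else 0 := by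
  classical
  have h1 : ∀ w ∈ words n d, 1 = (if w = Word.nil then 1 else 0) +
      ∑ A : Finset (Fin n), ∑ k ∈ Finset.Icc 1 A.card,
        if w.1.head? = some (A, k) then 1 else 0 := by
    intro w _
    rcases Word.eq_nil_or_extend w with rfl | ⟨B, j, w, h1, h2, h3, rfl⟩
    · simp [Word.nil]
    · have hne : w.extend B j ≠ Word.nil := by
        intro h
        have := congrArg Subtype.val h
        rw [Word.extend_val h1 h2 h3] at this
        simp [Word.nil] at this
      rw [if_neg hne, Word.extend_val h1 h2 h3, Finset.sum_eq_single_of_mem B (Finset.mem_univ _),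
        Finset.sum_eq_single_of_mem j (Finset.mem_Icc.2 ⟨h1, h2⟩)]
      · simp
      · intro k _ hk
        simp [hk.symm]
      · intro A _ hA
        simp [hA.symm]
  rw [Finset.card_eq_sum_ones, Finset.sum_congr rfl h1, Finset.sum_add_distrib]
  congr 1
  · rw [← Finset.card_filter, Finset.filter_eq']
    have : Word.nil ∈ words n d ↔ d = 0 := by
      rw [mem_words, eq_comm]
      rfl
    simp only [this]
    split_ifs <;> rfl
  · rw [Finset.sum_comm]
    refine Finset.sum_congr rfl fun A _ => ?_
    rw [Finset.sum_comm]
    refine Finset.sum_congr rfl fun k hk => ?_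
    have hk := Finset.mem_Icc.1 hk
    rw [← Finset.card_filter, card_filter_head A hk.1 hk.2]

/-- A word not free for A ends in (B, |B|-|A|) for a unique B strictly containing A. -/
lemma card_words_eq_freeCount_add (A : Finset (Fin n)) (d : ℕ) : (words n d).card =
    freeCount A d + ∑ B ∈ (Finset.Icc A Finset.univ).erase A,
      if B.card - A.card ≤ d then freeCount B (d - (B.card - A.card)) else 0 := by
  classical
  have h1 : ∀ w ∈ words n d, 1 = (if Free A w.1 then 1 else 0) +
      ∑ B ∈ (Finset.Icc A Finset.univ).erase A,
        if w.1.head? = some (B, B.card - A.card) then 1 else 0 := by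
    intro w _
    rcases Word.free_or_exists A w with h | ⟨B, j, w, hw, hj, hAB, hc, rfl, -⟩
    · rw [if_pos h]
      symm
      refine (Nat.add_eq_left).2 (Finset.sum_eq_zero fun B hB => ?_)
      simp only [Finset.mem_erase, Finset.mem_Icc] at hB
      rw [if_neg]
      intro hh
      obtain ⟨t, ht⟩ := List.head?_eq_some_iff.1 hh
      rw [ht] at h
      exact h ⟨hB.2.1, Nat.add_sub_cancel' (Finset.card_le_card hB.2.1)⟩
    · have hnot : ¬ Free A (w.extend B j).1 := by
        rw [Word.extend_val hj (by omega) hw]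
        exact fun h => h ⟨hAB, hc⟩
      have hB : B ∈ (Finset.Icc A Finset.univ).erase A := by
        simp only [Finset.mem_erase, Finset.mem_Icc]
        refine ⟨?_, hAB, Finset.subset_univ _⟩
        rintro rfl
        omega
      rw [if_neg hnot, Finset.sum_eq_single_of_mem B hB, Word.extend_val hj (by omega) hw]
      · rw [if_pos]
        rw [List.head?_cons, ← hc, Nat.add_sub_cancel_left]
      · intro B' _ hB'
        rw [Word.extend_val hj (by omega) hw]
        simp [hB'.symm]
  rw [Finset.card_eq_sum_ones, Finset.sum_congr rfl h1, Finset.sum_add_distrib]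
  congr 1
  · rw [← Finset.card_filter, freeCount]
  · rw [Finset.sum_comm]
    refine Finset.sum_congr rfl fun B hB => ?_
    simp only [Finset.mem_erase, Finset.mem_Icc] at hB
    have hlt := Finset.card_lt_card (lt_of_le_of_ne hB.2.1 hB.1.symm)
    rw [← Finset.card_filter, card_filter_head B (by omega) (by omega)]

/-- The generating function of the normal words by degree. -/
def wordSeries (n : ℕ) : PowerSeries ℚ := PowerSeries.mk fun d => ((words n d).card : ℚ)

/-- The generating function of the normal words that may be followed by a letter `(A, k)`. -/
def freeSeries (A : Finset (Fin n)) : PowerSeries ℚ := PowerSeries.mk fun d => (freeCount A d : ℚ)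

open PowerSeries

lemma wordSeries_eq_one_add : wordSeries n =
    1 + ∑ A : Finset (Fin n), ∑ k ∈ Finset.Icc 1 A.card, freeSeries A * X ^ k := by
  ext d
  simp only [wordSeries, freeSeries, coeff_mk, map_add, map_sum, coeff_mul_X_pow', coeff_one,
    card_words d]
  push_cast
  rfl

lemma wordSeries_eq_freeSeries_add (A : Finset (Fin n)) : wordSeries n =
    freeSeries A + ∑ B ∈ (Finset.Icc A Finset.univ).erase A,
      freeSeries B * X ^ (B.card - A.card) := by
  ext d
  simp only [wordSeries, freeSeries, coeff_mk, map_add, map_sum, coeff_mul_X_pow',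
    card_words_eq_freeCount_add A d]
  push_cast
  rfl

/-- The binomial expansion of (x + (1 - x))^(n-|A|) over subsets of the complement of A. -/
lemma sum_Icc_univ_pow {R : Type*} [CommRing R] (x : R) (A : Finset (Fin n)) :
    ∑ B ∈ Finset.Icc A Finset.univ, (1 - x) ^ (n - B.card) * x ^ (B.card - A.card) = 1 := by
  rw [Finset.Icc_eq_image_powerset (Finset.subset_univ A), Finset.sum_image]
  · have h := Finset.sum_pow_mul_eq_add_pow x (1 - x) (Finset.univ \ A)
    rw [add_sub_cancel, one_pow] at h
    refine Eq.trans ?_ h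
    refine Finset.sum_congr rfl fun C hC => ?_
    have hd : Disjoint A C := by
      rw [Finset.disjoint_left]
      intro a ha ha'
      exact (Finset.mem_sdiff.1 (Finset.mem_powerset.1 hC ha')).2 ha
    rw [Finset.card_union_of_disjoint hd, Nat.add_sub_cancel_left, mul_comm,
      Finset.card_sdiff_of_subset (Finset.subset_univ A), Finset.card_univ, Fintype.card_fin,
      Nat.sub_sub]
  · intro C hC D hD h
    simp only [Finset.coe_powerset, Set.mem_preimage, Set.mem_powerset_iff] at hC hD
    ext a
    have ha := Finset.ext_iff.1 h a
    simp only [Finset.mem_union] at ha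
    have hC' : a ∈ C → a ∉ A := fun h' => (Finset.mem_sdiff.1 (hC h')).2
    have hD' : a ∈ D → a ∉ A := fun h' => (Finset.mem_sdiff.1 (hD h')).2
    tauto

/-- The system `wordSeries_eq_freeSeries_add` is triangular for inclusion, so induction on
codimension solves it; `sum_Icc_univ_pow` verifies the solution. -/
lemma freeSeries_eq (m : ℕ) : ∀ A : Finset (Fin n), n - A.card = m →
    freeSeries A = wordSeries n * (1 - X) ^ (n - A.card) := by
  induction m using Nat.strong_induction_on with
  | _ m ih =>
    intro A hA
    have h := wordSeries_eq_freeSeries_add A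
    have hsum : ∑ B ∈ (Finset.Icc A Finset.univ).erase A, freeSeries B * X ^ (B.card - A.card) =
        wordSeries n * ∑ B ∈ (Finset.Icc A Finset.univ).erase A,
          (1 - X) ^ (n - B.card) * X ^ (B.card - A.card) := by
      rw [Finset.mul_sum]
      refine Finset.sum_congr rfl fun B hB => ?_
      simp only [Finset.mem_erase, Finset.mem_Icc] at hB
      have hlt := Finset.card_lt_card (lt_of_le_of_ne hB.2.1 hB.1.symm)
      have hle := card_finset_fin_le B
      rw [ih (n - B.card) (by omega) B rfl, mul_assoc]
    have h1 := sum_Icc_univ_pow (X : PowerSeries ℚ) A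
    rw [← Finset.add_sum_erase _ _ (Finset.mem_Icc.2 ⟨le_rfl, Finset.subset_univ A⟩),
      Nat.sub_self, pow_zero, mul_one] at h1
    rw [hsum] at h
    linear_combination (-1 : PowerSeries ℚ) * h - (wordSeries n) * h1

lemma wordSeries_mul (n : ℕ) : wordSeries n * (1 - X * (2 - X) ^ n) = 1 - X := by
  have h := wordSeries_eq_one_add (n := n)
  have hA : ∀ A : Finset (Fin n), (1 - X) * ∑ k ∈ Finset.Icc 1 A.card, freeSeries A * X ^ k =
      wordSeries n * X * ((1 - X) ^ (n - A.card) - X ^ A.card * (1 - X) ^ (n - A.card)) := by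
    intro A
    have hg : (1 - X : PowerSeries ℚ) * ∑ k ∈ Finset.Icc 1 A.card, X ^ k = X * (1 - X ^ A.card) := by
      induction A.card with
      | zero => simp
      | succ a ih =>
        rw [Finset.sum_Icc_succ_top (by omega), mul_add, ih]
        ring
    rw [← Finset.mul_sum, mul_left_comm, hg, freeSeries_eq _ A rfl]
    ring
  -- Once the geometric sums over k are cleared by 1 - X, two sums over A remain: Σ (1-X)^(n-|A|) =
  -- (2-X)^n and Σ X^|A| (1-X)^(n-|A|) = 1.
  have h1 := Finset.sum_pow_mul_eq_add_pow (1 : PowerSeries ℚ) (1 - X)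
    (Finset.univ : Finset (Fin n))
  have h2 := Finset.sum_pow_mul_eq_add_pow (X : PowerSeries ℚ) (1 - X)
    (Finset.univ : Finset (Fin n))
  simp only [Finset.powerset_univ, Finset.card_univ, Fintype.card_fin, one_pow, one_mul,
    add_sub_cancel] at h1 h2
  have h3 : (1 - X) * wordSeries n = (1 - X) + wordSeries n * X * ((1 + (1 - X)) ^ n - 1) := by
    conv_lhs => rw [h]
    rw [mul_add, mul_one, Finset.mul_sum, Finset.sum_congr rfl fun A _ => hA A, ← Finset.mul_sum,
      Finset.sum_sub_distrib, h1, h2]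
  rw [show (1 : PowerSeries ℚ) + (1 - X) = 2 - X by ring] at h3
  linear_combination h3

end Counting

/-! ### The Hilbert series -/

section HilbertSeries

open PowerSeries

variable (F : Type*) [Field F]

lemma HQ_eq_wordSeries (n : ℕ) : HQ F n = wordSeries n := by
  have h : HQ F n = mk fun d => (Module.finrank F (Qgrade F n d) : ℚ) := rfl
  ext d
  rw [h, wordSeries, coeff_mk, coeff_mk, finrank_Qgrade, words,
    Set.ncard_eq_toFinset_card _ (finite_wordDegree_eq d)]

lemma constantCoeff_HQ (n : ℕ) : constantCoeff (HQ F n) = 1 := by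
  have h := congrArg constantCoeff (wordSeries_mul n)
  rw [HQ_eq_wordSeries]
  simpa using h

lemma HQ_inv (n : ℕ) : (HQ F n)⁻¹ = (1 - X * (2 - X) ^ n) * (1 - X)⁻¹ := by
  have h1 : constantCoeff (1 - X : PowerSeries ℚ) ≠ 0 := by simp
  have h2 : constantCoeff (HQ F n) ≠ 0 := by simp [constantCoeff_HQ]
  rw [eq_comm, PowerSeries.eq_inv_iff_mul_eq_one h2, mul_right_comm, mul_comm _ (HQ F n),
    HQ_eq_wordSeries, wordSeries_mul, PowerSeries.mul_inv_cancel _ h1]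

lemma Qgrade_finite (n i : ℕ) : Module.Finite F (Qgrade F n i) := by
  rw [Qgrade_eq_span]
  exact Module.Finite.span_of_finite F ((finite_wordDegree_eq i).image _)

end HilbertSeries

end

end PseudoRoots

theorem corollary4p9 (F : Type*) [Field F] :
    -- the Hilbert series are defined (the components form a grading and are finite-dimensional)
    -- and are invertible formal power series
    (∀ m : ℕ, DirectSum.IsInternal (PseudoRoots.Qgrade F m) ∧
      (∀ i : ℕ, Module.Finite F (PseudoRoots.Qgrade F m i)) ∧
      IsUnit (PseudoRoots.HQ F m)) ∧
    -- the recursion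
    ∀ n : ℕ, 1 ≤ n →
      (PseudoRoots.HQ F n)⁻¹ =
        (2 - PowerSeries.X) * (PseudoRoots.HQ F (n - 1))⁻¹ - 1 := by
  refine ⟨fun m => ⟨PseudoRoots.Qgrade_isInternal, PseudoRoots.Qgrade_finite F m, ?_⟩,
    fun n hn => ?_⟩
  · rw [PowerSeries.isUnit_iff_constantCoeff, PseudoRoots.constantCoeff_HQ]
    exact isUnit_one
  · obtain ⟨m, rfl⟩ := Nat.exists_eq_add_of_le' hn
    have h : (1 - PowerSeries.X : PowerSeries ℚ) * (1 - PowerSeries.X)⁻¹ = 1 :=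
      PowerSeries.mul_inv_cancel _ (by simp)
    rw [Nat.add_sub_cancel, PseudoRoots.HQ_inv, PseudoRoots.HQ_inv]
    -- Up to the factor 1/(1-X), this is (2-X)(1 - X(2-X)^m) - (1-X) = 1 - X(2-X)^(m+1).
    linear_combination (-1 : PowerSeries ℚ) * h
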